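/- Let $A\in\mathbb{R}^{m\times n}$ have full row rank, $b\in\mathbb{R}^m$, and let $\phi:\mathbb{R}^n\to\mathbb{R}$ be continuously differentiable (not necessarily convex). Put $\mathcal{C}_{A,b}=\{x\in\mathbb{R}^n: Ax=b,\ x\ge 0\}$ and $\mathcal{P}_{A,b}=\{y\in\mathbb{R}^n: A(y\circ y)=b\}$, assumed nonempty, where $\circ$ is the entrywise product, and consider the problem (LCP) $\min\{\phi(x): x\in\mathcal{C}_{A,b}\}$ and the function $f(y)=\phi(y\circ y)$. *Strata.* For $y\in\mathcal{P}_{A,b}$ a regular representation $(M,N,r)$ consists of matrices $M\in\mathbb{R}^{r\times m}$, $N\in\mathbb{R}^{(m-r)\times m}$ whose rows are bases of $\mathrm{Range}[A\,\mathrm{Diag}(y)]$ and of its orthogonal complement in $\mathbb{R}^m$, respectively. Let $\mathcal{M}(y)$ be the set of all $z\in\mathcal{P}_{A,b}$ sharing a regular representation with $y$, let $\mathcal{I}=\bigcup_{z\in\mathcal{M}(y)}\mathrm{supp}(z)$, let $\mathrm{T}_y\mathcal{M}(y)=\{h: MA(y\circ h)=0,\ \mathrm{supp}(h)\subset\mathcal{I}\}$,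 and let $\mathrm{grad} f(y)$ be the orthogonal projection of $2\nabla\phi(y\circ y)\circ y$ onto $\mathrm{T}_y\mathcal{M}(y)$. Let $\mathrm{Retr}$ be a retraction on the strata: for every stratum $\mathcal{M}$, a smooth map $\mathrm{T}\mathcal{M}\to\mathcal{M}$ with $\mathrm{Retr}(z,0)=z$ and $\mathrm{D}\,\mathrm{Retr}(z,0)[h]=h$ for $z\in\mathcal{M}$, $h\in\mathrm{T}_z\mathcal{M}$. For $\sigma>0$, $y$ is called $\sigma$-regular if in the decomposition $A\,\mathrm{Diag}(y\circ y)A^\top=L\,\mathrm{Diag}(d)L^\top$ with $L$ unit lower triangular and $d\ge0$ (in which $d$ is unique) all nonzero entries of $d$ are at least $\sigma$; otherwise $y$ is $\sigma$-singular. Put $h_t(x)=\|\mathrm{Proj}_{\mathcal{C}_{A,b}}(x-t\nabla\phi(x))-x\|/t$. *Algorithm 1.* Given $\delta,\sigma,\epsilon\in(0,1)$ and $y_0\in\mathcal{P}_{A,b}$, for $k=0,1,2,\dots$, with $x_k=y_k\circ y_k$: (a) if $y_k$ is $\sigma$-regular and $\|\mathrm{grad} f(y_k)\|>\epsilon$,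 set $y_{k+1}=\mathrm{Retr}(y_k,-t\,\mathrm{grad} f(y_k))$, where $t=(1/2)^j$ for the least integer $j\ge0$ such that $f(\mathrm{Retr}(y_k,-t\,\mathrm{grad} f(y_k)))\le f(y_k)-t\,\delta\,\|\mathrm{grad} f(y_k)\|^2$; (b) otherwise, set $y_{k+1}=\sqrt{x^+}$ (entrywise) with $x^+=\mathrm{Proj}_{\mathcal{C}_{A,b}}(x_k-t\nabla\phi(x_k))$, where $t=(1/2)^j$ for the least integer $j\ge1$ such that $\phi(x^+)\le\phi(x_k)-t\,\delta\,h_t(x_k)^2$. **Theorem.** For all $\delta,\sigma,\epsilon\in(0,1)$ and $y_0\in\mathcal{P}_{A,b}$, if $(y_k)$ is the sequence generated by Algorithm 1 and $y^*$ is any accumulation point of it, then $x^*=y^*\circ y^*$ is a first-order stationary point of (LCP): there is $\lambda\in\mathbb{R}^m$ with $Ax^*=b$, $x^*\ge0$, $\nabla\phi(x^*)-A^\top\lambda\ge0$ and $(\nabla\phi(x^*)-A^\top\lambda)\circ x^*=0$. -/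

import Mathlib

open scoped Matrix ContDiff

noncomputable section

namespace HadamardLCP

/-- The Euclidean space `ℝⁿ` (with the Euclidean norm). -/
abbrev E (n : ℕ) := EuclideanSpace ℝ (Fin n)

/-- The Hadamard (entrywise) product `y ∘ z`. -/
def had {n : ℕ} (y z : E n) : E n := WithLp.toLp 2 (fun i => y i * z i)

/-- The entrywise square root. -/
def sqrtVec {n : ℕ} (x : E n) : E n := WithLp.toLp 2 (fun i => Real.sqrt (x i))

/-- The convex polyhedron `C_{A,b} = {x : A x = b, x ≥ 0}`. -/
def polyhedron {m n : ℕ} (A : Matrix (Fin m) (Fin n) ℝ) (b : Fin m → ℝ) : Set (E n) :=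
  {x | A *ᵥ x.ofLp = b ∧ ∀ i, 0 ≤ x i}

/-- The parametrized polyhedron `P_{A,b} = {y : A (y ∘ y) = b}`. -/
def paramPolyhedron {m n : ℕ} (A : Matrix (Fin m) (Fin n) ℝ) (b : Fin m → ℝ) : Set (E n) :=
  {y | A *ᵥ (had y y).ofLp = b}

/-- `x` is a first-order stationary (KKT) point of `min {φ x : A x = b, x ≥ 0}`. -/
def IsKKTPoint {m n : ℕ} (A : Matrix (Fin m) (Fin n) ℝ) (b : Fin m → ℝ) (φ : E n → ℝ)
    (x : E n) : Prop :=
  ∃ l : Fin m → ℝ,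
    (A *ᵥ x.ofLp = b ∧ ∀ i, 0 ≤ x i) ∧
    (∀ i, 0 ≤ gradient φ x i - (Aᵀ *ᵥ l) i) ∧
    (∀ i, (gradient φ x i - (Aᵀ *ᵥ l) i) * x i = 0)

/-! Stratification -/

/-- The range of the matrix `A Diag(y)`, a subspace of `ℝᵐ`. -/
def rangeADiag {m n : ℕ} (A : Matrix (Fin m) (Fin n) ℝ) (y : E n) : Submodule ℝ (Fin m → ℝ) :=
  LinearMap.range (A * Matrix.diagonal y.ofLp).mulVecLin

/-- `(M, N, r)` is a regular representation of `y`: the rows of `M` are a basis of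
`Range[A Diag(y)]` and the rows of `N` are a basis of its orthogonal complement in `ℝᵐ`
(so that `r + s = m` and `[M; N]` is an invertible `m × m` matrix). -/
structure IsRegularRep {m n r s : ℕ} (A : Matrix (Fin m) (Fin n) ℝ) (y : E n)
    (M : Matrix (Fin r) (Fin m) ℝ) (N : Matrix (Fin s) (Fin m) ℝ) : Prop where
  linInd_M : LinearIndependent ℝ (fun i => M i)
  span_M : Submodule.span ℝ (Set.range (fun i => M i)) = rangeADiag A y
  linInd_N : LinearIndependent ℝ (fun i => N i)
  span_N : (Submodule.span ℝ (Set.range (fun i => N i)) : Set (Fin m → ℝ)) =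
    {v | ∀ u ∈ rangeADiag A y, u ⬝ᵥ v = 0}

/-- `y` and `z` share a regular representation. -/
def SameRep {m n : ℕ} (A : Matrix (Fin m) (Fin n) ℝ) (y z : E n) : Prop :=
  ∃ (r s : ℕ) (M : Matrix (Fin r) (Fin m) ℝ) (N : Matrix (Fin s) (Fin m) ℝ),
    IsRegularRep A y M N ∧ IsRegularRep A z M N

/-- The stratum `M(y)`: the points of `P_{A,b}` equivalent to `y`. -/
def stratum {m n : ℕ} (A : Matrix (Fin m) (Fin n) ℝ) (b : Fin m → ℝ) (y : E n) : Set (E n) :=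
  {z | z ∈ paramPolyhedron A b ∧ SameRep A z y}

/-- The maximal support of the stratum of `y`: the union of the supports of its points. -/
def maxSupport {m n : ℕ} (A : Matrix (Fin m) (Fin n) ℝ) (b : Fin m → ℝ) (y : E n) :
    Set (Fin n) :=
  {i | ∃ z ∈ stratum A b y, z i ≠ 0}

/-- The tangent space at `y` of the stratum `M(y)`: the vectors `h` supported in the maximal
support with `M A (y ∘ h) = 0`. The latter is equivalent to `A (y ∘ h) = 0`, because
`N A Diag(y) = 0` and `[M; N]` is invertible. -/
def tangentSpace {m n : ℕ} (A : Matrix (Fin m) (Fin n) ℝ) (b : Fin m → ℝ) (y : E n) :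
    Submodule ℝ (E n) where
  carrier := {h | A *ᵥ (had y h).ofLp = 0 ∧ ∀ i, h i ≠ 0 → i ∈ maxSupport A b y}
  zero_mem' := by
    refine ⟨?_, fun i hi => absurd rfl hi⟩
    have : (had y (0 : E n)).ofLp = 0 := by ext i; simp [had]
    rw [this, Matrix.mulVec_zero]
  add_mem' := by
    rintro g h ⟨hg, hg'⟩ ⟨hh, hh'⟩
    refine ⟨?_, fun i hi => ?_⟩
    · have : (had y (g + h)).ofLp = (had y g).ofLp + (had y h).ofLp := by
        ext i; simp [had, mul_add]
      rw [this, Matrix.mulVec_add, hg, hh, add_zero]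
    · by_cases h0 : g i = 0
      · refine hh' i fun h1 => hi ?_
        simp [h0, h1]
      · exact hg' i h0
  smul_mem' := by
    rintro c h ⟨hh, hh'⟩
    refine ⟨?_, fun i hi => hh' i fun h0 => hi (by simp [h0])⟩
    have : (had y (c • h)).ofLp = c • (had y h).ofLp := by
      ext i; simp [had, mul_left_comm]
    rw [this, Matrix.mulVec_smul, hh, smul_zero]

/-- The tangent bundle of the stratum `M(y)`, as a subset of `ℝⁿ × ℝⁿ`. -/
def tangentBundle {m n : ℕ} (A : Matrix (Fin m) (Fin n) ℝ) (b : Fin m → ℝ) (y : E n) :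
    Set (E n × E n) :=
  {p | p.1 ∈ stratum A b y ∧ p.2 ∈ tangentSpace A b p.1}

/-- The Riemannian gradient at `y` of `f(y) = φ(y ∘ y)` on the stratum of `y`: the orthogonal
projection onto the tangent space of the Euclidean gradient `2 ∇φ(y ∘ y) ∘ y` of `f`. -/
def rgrad {m n : ℕ} (A : Matrix (Fin m) (Fin n) ℝ) (b : Fin m → ℝ) (φ : E n → ℝ) (y : E n) :
    E n :=
  (tangentSpace A b y).starProjection ((2 : ℝ) • had (gradient φ (had y y)) y)

/-- `R` restricts to a retraction on every stratum: it maps the tangent bundle of each stratum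
smoothly to that stratum, with `R(z, 0) = z` and `D R(z, 0)[h] = h` for all tangent vectors
`h` at `z`. The values of `R` off the tangent bundles are irrelevant. -/
structure IsRetraction {m n : ℕ} (A : Matrix (Fin m) (Fin n) ℝ) (b : Fin m → ℝ)
    (R : E n → E n → E n) : Prop where
  maps : ∀ y ∈ paramPolyhedron A b, ∀ p ∈ tangentBundle A b y, R p.1 p.2 ∈ stratum A b y
  smooth : ∀ y ∈ paramPolyhedron A b,
    ContDiffOn ℝ ∞ (fun p : E n × E n => R p.1 p.2) (tangentBundle A b y)
  map_zero : ∀ z ∈ paramPolyhedron A b, R z 0 = z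
  deriv_zero : ∀ z ∈ paramPolyhedron A b,
    HasFDerivWithinAt (R z) (ContinuousLinearMap.id ℝ (E n)) (tangentSpace A b z : Set (E n)) 0

/-! Near-singularity through the LDL decomposition -/

/-- `S = L Diag(d) Lᵀ` with `L` unit lower triangular and `d ≥ 0`. -/
structure IsLDL {m : ℕ} (S L : Matrix (Fin m) (Fin m) ℝ) (d : Fin m → ℝ) : Prop where
  lower : ∀ i j, i < j → L i j = 0
  unit_diag : ∀ i, L i i = 1
  nonneg : ∀ i, 0 ≤ d i
  eq : S = L * Matrix.diagonal d * Lᵀ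

/-- `y` is `σ`-regular: in the LDL decomposition of `A Diag(y ∘ y) Aᵀ` (such a decomposition
exists and its `d` is unique), every nonzero entry of `d` is at least `σ`. -/
def SigmaRegular {m n : ℕ} (A : Matrix (Fin m) (Fin n) ℝ) (σ : ℝ) (y : E n) : Prop :=
  ∃ (L : Matrix (Fin m) (Fin m) ℝ) (d : Fin m → ℝ),
    IsLDL (A * Matrix.diagonal (had y y).ofLp * Aᵀ) L d ∧ ∀ i, d i ≠ 0 → σ ≤ d i

/-! Projected gradient -/

/-- The orthogonal projection of `u` onto `C`: a point of `C` at least distance from `u`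
(it exists and is unique when `C` is nonempty, closed and convex). -/
def metricProj {n : ℕ} (C : Set (E n)) (u : E n) : E n :=
  Classical.epsilon fun p => p ∈ C ∧ ∀ q ∈ C, ‖p - u‖ ≤ ‖q - u‖

/-- The projected gradient point `Proj_C(x - t ∇φ(x))`, where `C = C_{A,b}`. -/
def pgPoint {m n : ℕ} (A : Matrix (Fin m) (Fin n) ℝ) (b : Fin m → ℝ) (φ : E n → ℝ)
    (t : ℝ) (x : E n) : E n :=
  metricProj (polyhedron A b) (x - t • gradient φ x)

/-- `h_t(x) = ‖Proj_C(x - t ∇φ(x)) - x‖ / t`. -/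
def pgResidual {m n : ℕ} (A : Matrix (Fin m) (Fin n) ℝ) (b : Fin m → ℝ) (φ : E n → ℝ)
    (t : ℝ) (x : E n) : ℝ :=
  ‖pgPoint A b φ t x - x‖ / t

/-! The algorithm -/

/-- Sufficient decrease of the Riemannian gradient step of size `t` at `y`. -/
def RGDDecrease {m n : ℕ} (A : Matrix (Fin m) (Fin n) ℝ) (b : Fin m → ℝ) (φ : E n → ℝ)
    (R : E n → E n → E n) (δ t : ℝ) (y : E n) : Prop :=
  φ (had (R y (-(t • rgrad A b φ y))) (R y (-(t • rgrad A b φ y)))) ≤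
    φ (had y y) - t * δ * ‖rgrad A b φ y‖ ^ 2

/-- Sufficient decrease of the projected gradient step of size `t` at `x`. -/
def PGDDecrease {m n : ℕ} (A : Matrix (Fin m) (Fin n) ℝ) (b : Fin m → ℝ) (φ : E n → ℝ)
    (δ t : ℝ) (x : E n) : Prop :=
  φ (pgPoint A b φ t x) ≤ φ x - t * δ * pgResidual A b φ t x ^ 2

/-- The Riemannian gradient step from `y` to `y'`; the step size is `(1/2)^k` for the least
natural number `k` that gives sufficient decrease. -/
def RGDStep {m n : ℕ} (A : Matrix (Fin m) (Fin n) ℝ) (b : Fin m → ℝ) (φ : E n → ℝ)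
    (R : E n → E n → E n) (δ : ℝ) (y y' : E n) : Prop :=
  ∃ k : ℕ, IsLeast {k : ℕ | RGDDecrease A b φ R δ ((1 / 2 : ℝ) ^ k) y} k ∧
    y' = R y (-(((1 / 2 : ℝ) ^ k) • rgrad A b φ y))

/-- The projected gradient step from `y` to `y'`, carried out at `x = y ∘ y`; the step size is
`(1/2)^k` for the least positive integer `k` that gives sufficient decrease. -/
def PGDStep {m n : ℕ} (A : Matrix (Fin m) (Fin n) ℝ) (b : Fin m → ℝ) (φ : E n → ℝ)
    (δ : ℝ) (y y' : E n) : Prop :=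
  ∃ k : ℕ, IsLeast {k : ℕ | 1 ≤ k ∧ PGDDecrease A b φ δ ((1 / 2 : ℝ) ^ k) (had y y)} k ∧
    y' = sqrtVec (pgPoint A b φ ((1 / 2 : ℝ) ^ k) (had y y))

/-- One iteration of the hybrid algorithm: a Riemannian gradient step if `y` is `σ`-regular and
its Riemannian gradient has norm greater than `ε`, and a projected gradient step otherwise. -/
def AlgStep {m n : ℕ} (A : Matrix (Fin m) (Fin n) ℝ) (b : Fin m → ℝ) (φ : E n → ℝ)
    (R : E n → E n → E n) (δ σ ε : ℝ) (y y' : E n) : Prop :=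
  ((SigmaRegular A σ y ∧ ε < ‖rgrad A b φ y‖) ∧ RGDStep A b φ R δ y y') ∨
  ((¬ SigmaRegular A σ y ∨ ‖rgrad A b φ y‖ ≤ ε) ∧ PGDStep A b φ δ y y')

/-- `y 0, y 1, …` is the sequence generated by the hybrid algorithm from `y₀`. -/
structure IsAlgSequence {m n : ℕ} (A : Matrix (Fin m) (Fin n) ℝ) (b : Fin m → ℝ)
    (φ : E n → ℝ) (R : E n → E n → E n) (δ σ ε : ℝ) (y₀ : E n) (y : ℕ → E n) : Prop where
  start : y 0 = y₀
  step : ∀ k, AlgStep A b φ R δ σ ε (y k) (y (k + 1))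

end HadamardLCP

end

/-! Every step decreases `φ`, so along an ultrafilter finer than `atTop` and converging to the
accumulation point the successive decreases tend to zero (`tendsto_decrease_zero`). The ultrafilter
replaces repeated passage to subsequences, and it selects one of the two step types.

Riemannian steps cannot be selected. The gradients stay above `ε`, so vanishing decrease forces the
accepted step sizes to zero, and the rejected trials of twice that size tend to zero too. Pivots
bounded below by `σ` prevent the rank from dropping in the limit (`eventually_rank_le_of_tendsto`),
so the iterates lie in the stratum of the limit itself (`eventually_rangeADiag_eq`). There the
retraction is smooth up to the limit point and its first-order expansion is uniform
(`isLittleO_of_contDiffWithinAt`), so small trials must succeed, a contradiction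
(`not_tendsto_zero_of_not_RGDDecrease`).

For projected gradient steps, either the step sizes have a positive limit, and sufficient decrease
sends the residuals to zero, or they vanish, and the rejected trials have vanishing residuals
(`tendsto_pgResidual_of_not_decrease`). In both cases the limit satisfies the variational inequality
(`variational_of_tendsto_pgResidual`), and Farkas' lemma turns it into multipliers
(`isKKTPoint_of_variational`). -/

/-! ### Farkas' lemma. -/

/-- Farkas' lemma: a linear functional that is nonnegative wherever finitely many given functionals
are nonnegative is a nonnegative combination of them. -/
theorem farkas_linear {ι V : Type*} [AddCommGroup V] [Module ℝ V] (s : Finset ι) :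
    ∀ (a : ι → V →ₗ[ℝ] ℝ) (b : V →ₗ[ℝ] ℝ),
      (∀ v, (∀ i ∈ s, 0 ≤ a i v) → 0 ≤ b v) →
      ∃ c : ι → ℝ, (∀ i ∈ s, 0 ≤ c i) ∧ ∀ v, b v = ∑ i ∈ s, c i * a i v := by
  classical
  induction s using Finset.induction_on with
  | empty =>
    intro a b h
    refine ⟨0, by simp, fun v => ?_⟩
    have h1 := h v (by simp)
    have h2 := h (-v) (by simp)
    rw [map_neg] at h2
    simp only [Finset.sum_empty]
    linarith
  | insert j s hj ih =>
    intro a b h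
    by_cases hb : ∀ v, (∀ i ∈ s, 0 ≤ a i v) → 0 ≤ b v
    · obtain ⟨c, hc, hbc⟩ := ih a b hb
      refine ⟨Function.update c j 0, fun i hi => ?_, fun v => ?_⟩
      · by_cases hij : i = j
        · simp [hij]
        · rw [Function.update_of_ne hij]
          exact hc i ((Finset.mem_insert.1 hi).resolve_left hij)
      · rw [Finset.sum_insert hj, hbc v]
        simp only [Function.update_self, zero_mul, zero_add]
        refine Finset.sum_congr rfl fun i hi => ?_
        rw [Function.update_of_ne (ne_of_mem_of_not_mem hi hj)]
    · push Not at hb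
      obtain ⟨w, hw, hbw⟩ := hb
      have hjw : a j w < 0 := by
        by_contra hcon
        refine absurd (h w fun i hi => ?_) (not_le.2 hbw)
        rcases Finset.mem_insert.1 hi with rfl | hi
        · exact not_lt.1 hcon
        · exact hw i hi
      -- With this scaling, `v ↦ v + (r * a j v) • w` projects along `w` onto the kernel of `a j`.
      -- The induction hypothesis is applied to the functionals pulled back along this projection,
      -- for which constraint `j` is vacuous.
      set r : ℝ := -(a j w)⁻¹ with hr
      have hr0 : 0 < r := by rw [hr]; have := inv_lt_zero.2 hjw; linarith
      have hrj : r * a j w = -1 := by rw [hr, neg_mul, inv_mul_cancel₀ hjw.ne]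
      obtain ⟨c, hc, hbc⟩ := ih (fun i => a i + (r * a i w) • a j) (b + (r * b w) • a j) (by
        intro v hv
        have := h (v + (r * a j v) • w) (fun i hi => by
          rcases Finset.mem_insert.1 hi with rfl | hi
          · simp only [map_add, map_smul, smul_eq_mul]
            have : a i v + r * a i v * a i w = a i v * (1 + r * a i w) := by ring
            rw [this, hrj]; simp
          · have := hv i hi
            simp only [LinearMap.add_apply, LinearMap.smul_apply, smul_eq_mul] at this
            simp only [map_add, map_smul, smul_eq_mul]
            linarith)
        simp only [map_add, map_smul, smul_eq_mul] at this
        simp only [LinearMap.add_apply, LinearMap.smul_apply, smul_eq_mul]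
        linarith)
      refine ⟨Function.update c j (∑ i ∈ s, c i * (r * a i w) - r * b w), fun i hi => ?_,
        fun v => ?_⟩
      · by_cases hij : i = j
        · subst hij
          rw [Function.update_self]
          have h1 : 0 ≤ ∑ i ∈ s, c i * (r * a i w) := Finset.sum_nonneg fun i hi =>
            mul_nonneg (hc i hi) (mul_nonneg hr0.le (hw i hi))
          have h2 : r * b w < 0 := mul_neg_of_pos_of_neg hr0 hbw
          linarith
        · rw [Function.update_of_ne hij]
          exact hc i ((Finset.mem_insert.1 hi).resolve_left hij)
      · have h1 := hbc v
        simp only [LinearMap.add_apply, LinearMap.smul_apply, smul_eq_mul, mul_add,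
          Finset.sum_add_distrib] at h1
        have h2 : ∑ i ∈ s, c i * (r * a i w * a j v) = (∑ i ∈ s, c i * (r * a i w)) * a j v := by
          rw [Finset.sum_mul]; exact Finset.sum_congr rfl fun i _ => by ring
        rw [Finset.sum_insert hj, Function.update_self]
        have h3 : ∑ i ∈ s, Function.update c j (∑ i ∈ s, c i * (r * a i w) - r * b w) i * a i v =
            ∑ i ∈ s, c i * a i v := Finset.sum_congr rfl fun i hi => by
          rw [Function.update_of_ne (ne_of_mem_of_not_mem hi hj)]
        rw [h3]
        linarith

namespace HadamardLCP

open Filter Topology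

variable {m n : ℕ}

/-! ### From the variational inequality to multipliers. -/

theorem eventually_add_smul_nonneg {x v : E n} (hx : ∀ i, 0 ≤ x i)
    (hv : ∀ i, x i = 0 → 0 ≤ v i) : ∀ᶠ t in 𝓝[>] (0 : ℝ), ∀ i, 0 ≤ (x + t • v) i := by
  rw [eventually_all]
  intro i
  rcases (hx i).eq_or_lt with h0 | hpos
  · filter_upwards [self_mem_nhdsWithin] with t ht
    have : 0 ≤ t * v i := mul_nonneg (le_of_lt ht) (hv i h0.symm)
    simpa [← h0] using this
  · have hc : Tendsto (fun t : ℝ => (x + t • v) i) (𝓝[>] 0) (𝓝 (x i)) := by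
      have : Continuous fun t : ℝ => x i + t * v i := by fun_prop
      simpa using (this.tendsto 0).mono_left nhdsWithin_le_nhds
    filter_upwards [hc.eventually (lt_mem_nhds hpos)] with t ht using le_of_lt ht

/-- A point of the polyhedron satisfying the first-order variational inequality is a KKT point. -/
theorem isKKTPoint_of_variational {A : Matrix (Fin m) (Fin n) ℝ} {b : Fin m → ℝ} {φ : E n → ℝ}
    {x : E n} (hx : x ∈ polyhedron A b)
    (hvar : ∀ q ∈ polyhedron A b, 0 ≤ inner ℝ (gradient φ x) (q - x)) : IsKKTPoint A b φ x := by
  classical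
  set g := gradient φ x with hg
  have hinner : ∀ v : E n, inner ℝ g v = ∑ i, g i * v i := fun v => by
    simp [PiLp.inner_apply, mul_comm]
  have hdir : ∀ v : E n, A *ᵥ v.ofLp = 0 → (∀ i, x i = 0 → 0 ≤ v i) → 0 ≤ inner ℝ g v := by
    intro v hAv hv
    obtain ⟨t, ht, ht0⟩ :=
      ((eventually_add_smul_nonneg hx.2 hv).and self_mem_nhdsWithin).exists
    have := hvar (x + t • v) ⟨by
      rw [WithLp.ofLp_add, WithLp.ofLp_smul, Matrix.mulVec_add, Matrix.mulVec_smul, hAv,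
        smul_zero, add_zero, hx.1], ht⟩
    rw [add_sub_cancel_left, inner_smul_right] at this
    exact nonneg_of_mul_nonneg_right this ht0
  let row : Fin m → E n →ₗ[ℝ] ℝ := fun j =>
    { toFun := fun v => (A *ᵥ v.ofLp) j
      map_add' := fun v w => by simp [Matrix.mulVec_add]
      map_smul' := fun c v => by simp [Matrix.mulVec_smul] }
  let coord : Fin n → E n →ₗ[ℝ] ℝ := fun i =>
    { toFun := fun v => v i
      map_add' := fun v w => by simp
      map_smul' := fun c v => by simp }
  -- Each equality constraint enters with both signs, so its multiplier is a difference of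
  -- nonnegative numbers. Only active coordinates enter as inequalities, which yields
  -- complementarity.
  obtain ⟨c, hc, hcv⟩ := farkas_linear
    (Finset.univ : Finset ((Fin m ⊕ Fin m) ⊕ {i : Fin n // x i = 0}))
    (Sum.elim (Sum.elim row (fun j => - row j)) (fun i => coord i)) (innerₛₗ ℝ g) (by
      intro v hv
      refine hdir v ?_ fun i hi => hv (Sum.inr ⟨i, hi⟩) (Finset.mem_univ _)
      ext j
      have h1 : 0 ≤ (A *ᵥ v.ofLp) j := hv (Sum.inl (Sum.inl j)) (Finset.mem_univ _)
      have h2 : 0 ≤ -(A *ᵥ v.ofLp) j := hv (Sum.inl (Sum.inr j)) (Finset.mem_univ _)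
      simp only [Pi.zero_apply]
      linarith)
  let l : Fin m → ℝ := fun j => c (Sum.inl (Sum.inl j)) - c (Sum.inl (Sum.inr j))
  have key : ∀ i, g i - (Aᵀ *ᵥ l) i = ∑ k : {i : Fin n // x i = 0},
      c (Sum.inr k) * (EuclideanSpace.single i (1 : ℝ) : E n) k := by
    intro i
    have := hcv (EuclideanSpace.single i 1)
    simp only [Fintype.sum_sum_type, Sum.elim_inl, Sum.elim_inr] at this
    have e1 : innerₛₗ ℝ g (EuclideanSpace.single i (1 : ℝ)) = g i := by
      rw [innerₛₗ_apply_apply, hinner]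
      simp
    have e2 : ∀ j, row j (EuclideanSpace.single i (1 : ℝ)) = A j i := fun j => by
      simp [row]
    rw [e1] at this
    simp only [LinearMap.neg_apply, e2] at this
    rw [this]
    have e3 : (Aᵀ *ᵥ l) i = ∑ j, c (Sum.inl (Sum.inl j)) * A j i +
        ∑ j, c (Sum.inl (Sum.inr j)) * -A j i := by
      rw [← Finset.sum_add_distrib]
      simp only [Matrix.mulVec, dotProduct, Matrix.transpose_apply, l]
      exact Finset.sum_congr rfl fun j _ => by ring
    rw [e3, add_sub_cancel_left]
    rfl
  refine ⟨l, hx, fun i => ?_, fun i => ?_⟩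
  · rw [key]
    refine Finset.sum_nonneg fun k _ => mul_nonneg (hc _ (Finset.mem_univ _)) ?_
    rw [PiLp.single_apply]
    split_ifs <;> norm_num
  · rw [key, Finset.sum_mul]
    refine Finset.sum_eq_zero fun k _ => ?_
    rw [PiLp.single_apply]
    split_ifs with h
    · rw [← h, k.2, mul_zero]
    · simp

/-! ### Projection onto the polyhedron and projected gradient steps. -/

theorem convex_polyhedron (A : Matrix (Fin m) (Fin n) ℝ) (b : Fin m → ℝ) :
    Convex ℝ (polyhedron A b) := by
  rintro p ⟨hp, hp0⟩ q ⟨hq, hq0⟩ s t hs ht hst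
  refine ⟨?_, fun i => ?_⟩
  · rw [WithLp.ofLp_add, WithLp.ofLp_smul, WithLp.ofLp_smul, Matrix.mulVec_add,
      Matrix.mulVec_smul, Matrix.mulVec_smul, hp, hq, ← add_smul, hst, one_smul]
  · exact add_nonneg (mul_nonneg hs (hp0 i)) (mul_nonneg ht (hq0 i))

theorem continuous_had : Continuous fun y : E n => had y y := by
  unfold had
  fun_prop

theorem isClosed_polyhedron (A : Matrix (Fin m) (Fin n) ℝ) (b : Fin m → ℝ) :
    IsClosed (polyhedron A b) := by
  have h1 : IsClosed {x : E n | A *ᵥ x.ofLp = b} :=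
    isClosed_eq (by fun_prop) continuous_const
  have h2 : IsClosed {x : E n | ∀ i, 0 ≤ x i} := by
    simp only [Set.ofPred_forall]
    exact isClosed_iInter fun i => isClosed_le continuous_const (by fun_prop)
  exact h1.inter h2

theorem isClosed_paramPolyhedron (A : Matrix (Fin m) (Fin n) ℝ) (b : Fin m → ℝ) :
    IsClosed (paramPolyhedron A b) := by
  have : Continuous fun y : E n => A *ᵥ (had y y).ofLp :=
    (by fun_prop : Continuous fun x : E n => A *ᵥ x.ofLp).comp continuous_had
  exact isClosed_eq this continuous_const

theorem had_self_mem_polyhedron {A : Matrix (Fin m) (Fin n) ℝ} {b : Fin m → ℝ} {y : E n}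
    (hy : y ∈ paramPolyhedron A b) : had y y ∈ polyhedron A b :=
  ⟨hy, fun i => mul_self_nonneg (y i)⟩

theorem had_sqrtVec {x : E n} (hx : ∀ i, 0 ≤ x i) : had (sqrtVec x) (sqrtVec x) = x := by
  ext i
  exact Real.mul_self_sqrt (hx i)

/-- The metric projection onto a nonempty closed convex set satisfies its variational
characterization. -/
theorem metricProj_spec {C : Set (E n)} (hne : C.Nonempty) (hcl : IsClosed C) (hconv : Convex ℝ C)
    (u : E n) : metricProj C u ∈ C ∧
      ∀ q ∈ C, inner ℝ (u - metricProj C u) (q - metricProj C u) ≤ 0 := by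
  -- `Classical.epsilon` gives no information until a minimizer is known to exist.
  have hex : ∃ p, p ∈ C ∧ ∀ q ∈ C, ‖p - u‖ ≤ ‖q - u‖ := by
    obtain ⟨p, hp, hpu⟩ := exists_norm_eq_iInf_of_complete_convex hne hcl.isComplete hconv u
    refine ⟨p, hp, fun q hq => ?_⟩
    rw [norm_sub_rev p, norm_sub_rev q, hpu]
    exact ciInf_le (f := fun w : C => ‖u - w‖) ⟨0, by rintro _ ⟨w, rfl⟩; exact norm_nonneg _⟩ ⟨q, hq⟩
  obtain ⟨h1, h2⟩ := Classical.epsilon_spec hex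
  change metricProj C u ∈ C at h1
  change ∀ q ∈ C, ‖metricProj C u - u‖ ≤ ‖q - u‖ at h2
  refine ⟨h1, (norm_eq_iInf_iff_real_inner_le_zero hconv h1).1 ?_⟩
  have : Nonempty C := ⟨⟨_, h1⟩⟩
  refine le_antisymm (le_ciInf fun w => ?_) ?_
  · rw [norm_sub_rev, norm_sub_rev u]
    exact h2 w w.2
  · exact ciInf_le (f := fun w : C => ‖u - w‖) ⟨0, by rintro _ ⟨w, rfl⟩; exact norm_nonneg _⟩ ⟨_, h1⟩

theorem pgPoint_mem {A : Matrix (Fin m) (Fin n) ℝ} {b : Fin m → ℝ} {x : E n}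
    (hx : x ∈ polyhedron A b) (φ : E n → ℝ) (t : ℝ) : pgPoint A b φ t x ∈ polyhedron A b :=
  (metricProj_spec ⟨x, hx⟩ (isClosed_polyhedron A b) (convex_polyhedron A b) _).1

theorem pgPoint_inner_le {A : Matrix (Fin m) (Fin n) ℝ} {b : Fin m → ℝ} {x q : E n}
    (hx : x ∈ polyhedron A b) (hq : q ∈ polyhedron A b) (φ : E n → ℝ) (t : ℝ) :
    inner ℝ (x - pgPoint A b φ t x) (q - pgPoint A b φ t x) ≤
      t * inner ℝ (gradient φ x) (q - pgPoint A b φ t x) := by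
  have := (metricProj_spec ⟨x, hx⟩ (isClosed_polyhedron A b) (convex_polyhedron A b)
    (x - t • gradient φ x)).2 q hq
  change inner ℝ (x - t • gradient φ x - pgPoint A b φ t x) (q - pgPoint A b φ t x) ≤ 0 at this
  rw [sub_right_comm, inner_sub_left, inner_smul_left] at this
  simp only [RCLike.conj_to_real] at this
  linarith

/-- The projected gradient step is a descent direction. -/
theorem norm_pgPoint_sub_sq_le {A : Matrix (Fin m) (Fin n) ℝ} {b : Fin m → ℝ} {x : E n}
    (hx : x ∈ polyhedron A b) (φ : E n → ℝ) (t : ℝ) :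
    ‖pgPoint A b φ t x - x‖ ^ 2 ≤ -(t * inner ℝ (gradient φ x) (pgPoint A b φ t x - x)) := by
  have := pgPoint_inner_le hx hx φ t
  rw [real_inner_self_eq_norm_sq, norm_sub_rev] at this
  rwa [← mul_neg, ← inner_neg_right, neg_sub]

theorem norm_pgPoint_sub_le {A : Matrix (Fin m) (Fin n) ℝ} {b : Fin m → ℝ} {x : E n}
    (hx : x ∈ polyhedron A b) (φ : E n → ℝ) {t : ℝ} (ht : 0 ≤ t) :
    ‖pgPoint A b φ t x - x‖ ≤ t * ‖gradient φ x‖ := by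
  have h1 := norm_pgPoint_sub_sq_le hx φ t
  have h2 := neg_le_of_abs_le (abs_real_inner_le_norm (gradient φ x) (pgPoint A b φ t x - x))
  by_contra hcon
  push Not at hcon
  have h3 := norm_nonneg (gradient φ x)
  have h5 : 0 < ‖pgPoint A b φ t x - x‖ := lt_of_le_of_lt (by positivity) hcon
  nlinarith [mul_lt_mul_of_pos_right hcon h5, mul_le_mul_of_nonneg_left h2 ht]

theorem fderiv_eq_inner_gradient {F : Type*} [NormedAddCommGroup F] [InnerProductSpace ℝ F]
    [CompleteSpace F] (φ : F → ℝ) (x v : F) :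
    fderiv ℝ φ x v = inner ℝ (gradient φ x) v := by
  rw [gradient, InnerProductSpace.toDual_symm_apply]

theorem continuous_gradient {F : Type*} [NormedAddCommGroup F] [InnerProductSpace ℝ F]
    [CompleteSpace F] {φ : F → ℝ} (hφ : ContDiff ℝ 1 φ) : Continuous (gradient φ) :=
  (InnerProductSpace.toDual ℝ F).symm.continuous.comp (hφ.continuous_fderiv one_ne_zero)

theorem mul_pgResidual {A : Matrix (Fin m) (Fin n) ℝ} {b : Fin m → ℝ} {φ : E n → ℝ} {t : ℝ}
    (ht : 0 < t) (x : E n) : t * pgResidual A b φ t x = ‖pgPoint A b φ t x - x‖ :=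
  mul_div_cancel₀ _ ht.ne'

theorem pgResidual_nonneg {A : Matrix (Fin m) (Fin n) ℝ} {b : Fin m → ℝ} {φ : E n → ℝ} {t : ℝ}
    (ht : 0 < t) (x : E n) : 0 ≤ pgResidual A b φ t x :=
  div_nonneg (norm_nonneg _) ht.le

/-- If the projected gradient residuals, for step sizes at most one, tend to zero along a
convergent family, then the limit satisfies the first-order variational inequality. -/
theorem variational_of_tendsto_pgResidual {κ : Type*} {l : Filter κ} [l.NeBot]
    {A : Matrix (Fin m) (Fin n) ℝ} {b : Fin m → ℝ} {φ : E n → ℝ} (hφ : ContDiff ℝ 1 φ)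
    {x : κ → E n} {a : E n} {s : κ → ℝ} (hx : ∀ k, x k ∈ polyhedron A b)
    (hlim : Tendsto x l (𝓝 a)) (hs : ∀ k, 0 < s k) (hs1 : ∀ᶠ k in l, s k ≤ 1)
    (hres : Tendsto (fun k => pgResidual A b φ (s k) (x k)) l (𝓝 0)) :
    ∀ q ∈ polyhedron A b, 0 ≤ inner ℝ (gradient φ a) (q - a) := by
  intro q hq
  have hpx : Tendsto (fun k => pgPoint A b φ (s k) (x k) - x k) l (𝓝 0) := by
    refine squeeze_zero_norm' ?_ hres
    filter_upwards [hs1] with k hk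
    rw [← mul_pgResidual (hs k)]
    exact mul_le_of_le_one_left (pgResidual_nonneg (hs k) _) hk
  have hp : Tendsto (fun k => pgPoint A b φ (s k) (x k)) l (𝓝 a) := by
    simpa using hpx.add hlim
  have hqp : Tendsto (fun k => q - pgPoint A b φ (s k) (x k)) l (𝓝 (q - a)) :=
    tendsto_const_nhds.sub hp
  have hL : Tendsto (fun k => -(pgResidual A b φ (s k) (x k) *
      ‖q - pgPoint A b φ (s k) (x k)‖)) l (𝓝 0) := by
    simpa using (hres.mul hqp.norm).neg
  have hR : Tendsto (fun k => inner ℝ (gradient φ (x k)) (q - pgPoint A b φ (s k) (x k))) l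
      (𝓝 (inner ℝ (gradient φ a) (q - a))) :=
    (((continuous_gradient hφ).tendsto a).comp hlim).inner hqp
  refine le_of_tendsto_of_tendsto' hL hR fun k => ?_
  have h1 := pgPoint_inner_le (hx k) hq φ (s k)
  have h2 := neg_le_of_abs_le (abs_real_inner_le_norm (x k - pgPoint A b φ (s k) (x k))
    (q - pgPoint A b φ (s k) (x k)))
  rw [norm_sub_rev (x k), ← mul_pgResidual (hs k)] at h2
  refine le_of_mul_le_mul_left ?_ (hs k)
  linarith

/-- If sufficient decrease of the projected gradient step fails for step sizes tending to zero
along a convergent family, then the residuals tend to zero. -/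
theorem tendsto_pgResidual_of_not_decrease {κ : Type*} {l : Filter κ}
    {A : Matrix (Fin m) (Fin n) ℝ} {b : Fin m → ℝ} {φ : E n → ℝ} (hφ : ContDiff ℝ 1 φ)
    {δ : ℝ} (hδ : δ < 1)
    {x : κ → E n} {a : E n} {s : κ → ℝ} (hx : ∀ k, x k ∈ polyhedron A b)
    (hlim : Tendsto x l (𝓝 a)) (hs : ∀ k, 0 < s k) (hs0 : Tendsto s l (𝓝 0))
    (hfail : ∀ᶠ k in l, ¬ PGDDecrease A b φ δ (s k) (x k)) :
    Tendsto (fun k => pgResidual A b φ (s k) (x k)) l (𝓝 0) := by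
  have hg : Tendsto (fun k => gradient φ (x k)) l (𝓝 (gradient φ a)) :=
    ((continuous_gradient hφ).tendsto a).comp hlim
  have hpx : Tendsto (fun k => pgPoint A b φ (s k) (x k) - x k) l (𝓝 0) := by
    refine squeeze_zero_norm (fun k => norm_pgPoint_sub_le (hx k) φ (hs k).le) ?_
    simpa using hs0.mul hg.norm
  have hp : Tendsto (fun k => pgPoint A b φ (s k) (x k)) l (𝓝 a) := by
    simpa using hpx.add hlim
  have hstrict := (hφ.contDiffAt (x := a)).hasStrictFDerivAt one_ne_zero
  have ho := hstrict.isLittleO.comp_tendsto (hp.prodMk_nhds hlim)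
  rw [Metric.tendsto_nhds]
  intro η hη
  -- Half of `η * (1 - δ)` pays for the remainder of `φ` at `a`, the other half for replacing `∇φ(x
  -- k)` by `∇φ(a)`. Failed decrease then leaves `h * (η - h) > 0`.
  have he : 0 < η * (1 - δ) / 2 := by have := sub_pos.2 hδ; positivity
  filter_upwards [hfail, ho.bound he, (Metric.tendsto_nhds.1 hg) _ he] with k hk1 hk2 hk3
  simp only [Function.comp_apply, fderiv_eq_inner_gradient, Real.norm_eq_abs] at hk2
  rw [dist_eq_norm] at hk3
  rw [PGDDecrease, not_le] at hk1
  have hsq := norm_pgPoint_sub_sq_le (hx k) φ (s k)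
  have hsk := hs k
  set p := pgPoint A b φ (s k) (x k)
  have hh := mul_pgResidual (A := A) (b := b) (φ := φ) (hs k) (x k)
  change _ = ‖p - x k‖ at hh
  have hh0 := pgResidual_nonneg (A := A) (b := b) (φ := φ) (hs k) (x k)
  rw [Real.dist_eq, sub_zero, abs_of_nonneg hh0]
  set h := pgResidual A b φ (s k) (x k)
  rw [← hh] at hk2 hsq
  have h4 : inner ℝ (gradient φ a) (p - x k) ≤
      inner ℝ (gradient φ (x k)) (p - x k) + η * (1 - δ) / 2 * (s k * h) := by
    have h5 := neg_le_of_abs_le (abs_real_inner_le_norm (gradient φ (x k) - gradient φ a) (p - x k))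
    rw [inner_sub_left, ← hh] at h5
    have h6 := mul_le_mul_of_nonneg_right hk3.le (mul_nonneg hsk.le hh0)
    linarith
  have h7 := le_of_abs_le hk2
  have h8 : s k * h ^ 2 ≤ - inner ℝ (gradient φ (x k)) (p - x k) := by
    refine le_of_mul_le_mul_left ?_ hsk
    linarith
  have h9 : 0 < s k * ((1 - δ) * (h * (η - h))) := by
    have : s k * ((1 - δ) * (h * (η - h))) =
      s k * δ * h ^ 2 - s k * h ^ 2 + 2 * (η * (1 - δ) / 2 * (s k * h)) := by ring
    rw [this]
    linarith
  have h10 := pos_of_mul_pos_right (pos_of_mul_pos_right h9 hsk.le) (sub_pos.2 hδ).le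
  exact sub_pos.1 (pos_of_mul_pos_right h10 hh0)

/-! Ranks -/

/-- The matrix on the right is the Gram matrix of the rows of `A Diag(y)`. This links the strata to
the LDL pivots. -/
theorem finrank_rangeADiag (A : Matrix (Fin m) (Fin n) ℝ) (y : E n) :
    Module.finrank ℝ (rangeADiag A y) = (A * Matrix.diagonal (had y y).ofLp * Aᵀ).rank := by
  have : A * Matrix.diagonal (had y y).ofLp * Aᵀ =
      (A * Matrix.diagonal y.ofLp) * (A * Matrix.diagonal y.ofLp)ᵀ := by
    rw [Matrix.transpose_mul, Matrix.diagonal_transpose, Matrix.mul_assoc, Matrix.mul_assoc,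
      ← Matrix.mul_assoc (Matrix.diagonal _) (Matrix.diagonal _), Matrix.diagonal_mul_diagonal]
    rfl
  rw [this, Matrix.rank_self_mul_transpose]
  rfl

/-- Nonzero column scalings do not affect the range, so only the support matters. -/
theorem rangeADiag_mono (A : Matrix (Fin m) (Fin n) ℝ) {y z : E n}
    (h : ∀ i, y i ≠ 0 → z i ≠ 0) : rangeADiag A y ≤ rangeADiag A z := by
  rintro _ ⟨v, rfl⟩
  refine ⟨fun i => y i / z i * v i, ?_⟩
  simp only [Matrix.mulVecLin_apply, ← Matrix.mulVec_mulVec]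
  congr 1
  ext i
  simp only [Matrix.mulVec_diagonal]
  by_cases hy : y i = 0
  · simp [hy]
  · have := h i hy
    field_simp

/-- A triangular matrix with nonnegative diagonal has rank at least the number of its nonzero
diagonal entries. -/
theorem card_le_rank_of_lower {M : Matrix (Fin m) (Fin m) ℝ} (hM : ∀ i j, i < j → M i j = 0)
    (h0 : ∀ i, 0 ≤ M i i) (J : Finset (Fin m)) (hJ : ∀ i ∈ J, 0 < M i i) : J.card ≤ M.rank := by
  classical
  -- Adding 1 to the diagonal off `J` makes the triangular matrix invertible at a rank cost of at
  -- most the size of the complement of `J`.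
  let e : Fin m → ℝ := fun i => if i ∈ J then 0 else 1
  have hdet : (M + Matrix.diagonal e).det ≠ 0 := by
    have htri : (M + Matrix.diagonal e).IsLowerTriangular := by
      intro i j hij
      have hij' : i < j := hij
      rw [Matrix.add_apply, hM i j hij', Matrix.diagonal_apply_ne _ hij'.ne, add_zero]
    rw [Matrix.det_of_isLowerTriangular _ htri, Finset.prod_ne_zero_iff]
    intro i _
    rw [Matrix.add_apply, Matrix.diagonal_apply_eq]
    by_cases hi : i ∈ J
    · simpa [e, hi] using (hJ i hi).ne'
    · have := h0 i
      simp only [e, hi, if_false]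
      linarith
  have hr : (M + Matrix.diagonal e).rank = m := by
    rw [Matrix.rank_of_isUnit _ ((Matrix.isUnit_iff_isUnit_det _).2 hdet.isUnit)]
    simp
  have hadd : (M + Matrix.diagonal e).rank ≤ M.rank + (Matrix.diagonal e).rank := by
    unfold Matrix.rank
    rw [Matrix.mulVecLin_add]
    exact (Submodule.finrank_mono (LinearMap.range_add_le _ _)).trans
      (Submodule.finrank_add_le_finrank_add_finrank _ _)
  have hd : (Matrix.diagonal e).rank = Jᶜ.card := by
    rw [Matrix.rank_diagonal, Fintype.card_subtype]
    congr 1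
    ext i
    simp [e]
  have := Finset.card_add_card_compl J
  rw [Fintype.card_fin] at this
  omega

/-- `S i i` is the squared norm of row `i` of `L √D`. Columns of `L` at zero pivots are arbitrary,
so `L` itself admits no such bound. -/
theorem IsLDL.sq_le {S L : Matrix (Fin m) (Fin m) ℝ} {d : Fin m → ℝ} (h : IsLDL S L d)
    (i j : Fin m) : (L * Matrix.diagonal fun k => Real.sqrt (d k)) i j ^ 2 ≤ S i i := by
  have : S i i = ∑ k, (L * Matrix.diagonal fun k => Real.sqrt (d k)) i k ^ 2 := by
    rw [h.eq, Matrix.mul_apply]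
    refine Finset.sum_congr rfl fun k _ => ?_
    rw [Matrix.mul_diagonal, Matrix.mul_diagonal, Matrix.transpose_apply, mul_pow,
      Real.sq_sqrt (h.nonneg k)]
    ring
  rw [this]
  exact Finset.single_le_sum (f := fun k => (L * Matrix.diagonal fun k => Real.sqrt (d k)) i k ^ 2)
    (fun k _ => sq_nonneg _) (Finset.mem_univ j)

theorem IsLDL.eq_mul_transpose {S L : Matrix (Fin m) (Fin m) ℝ} {d : Fin m → ℝ}
    (h : IsLDL S L d) : S = (L * Matrix.diagonal fun k => Real.sqrt (d k)) *
      (L * Matrix.diagonal fun k => Real.sqrt (d k))ᵀ := by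
  rw [Matrix.transpose_mul, Matrix.diagonal_transpose, Matrix.mul_assoc,
      ← Matrix.mul_assoc (Matrix.diagonal _) (Matrix.diagonal _), Matrix.diagonal_mul_diagonal]
  simp only [Real.mul_self_sqrt (h.nonneg _)]
  rw [← Matrix.mul_assoc, ← h.eq]

theorem exists_eventually_eq_of_finite {κ α : Type*} [Finite α] (U : Ultrafilter κ) (f : κ → α) :
    ∃ a, ∀ᶠ k in (U : Filter κ), f k = a := by
  exact Ultrafilter.eventually_exists_iff.1 (Eventually.of_forall fun k => ⟨f k, rfl⟩)

/-- Compactness of closed balls, in place of extracting a convergent subsequence. -/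
theorem exists_tendsto_of_eventually_norm_le {κ F : Type*} [NormedAddCommGroup F] [ProperSpace F]
    (U : Ultrafilter κ) (f : κ → F) {C : ℝ} (h : ∀ᶠ k in (U : Filter κ), ‖f k‖ ≤ C) :
    ∃ a, Tendsto f U (𝓝 a) := by
  obtain ⟨a, -, ha⟩ := (isCompact_closedBall (0 : F) C).ultrafilter_le_nhds (U.map f) (by
    rw [Ultrafilter.coe_map, le_principal_iff, mem_map]
    filter_upwards [h] with k hk
    simpa using hk)
  exact ⟨a, ha⟩

/-- The rank of matrices whose LDL decompositions have nonzero pivots bounded away from zero does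
not drop in the limit. -/
theorem eventually_rank_le_of_tendsto {κ : Type*} (U : Ultrafilter κ) {σ : ℝ} (hσ : 0 < σ)
    {S : κ → Matrix (Fin m) (Fin m) ℝ} {S' : Matrix (Fin m) (Fin m) ℝ}
    (hS : Tendsto S U (𝓝 S'))
    (hLDL : ∀ᶠ k in (U : Filter κ), ∃ (L : Matrix (Fin m) (Fin m) ℝ) (d : Fin m → ℝ),
      IsLDL (S k) L d ∧ ∀ i, d i ≠ 0 → σ ≤ d i) :
    ∀ᶠ k in (U : Filter κ), (S k).rank ≤ S'.rank := by
  classical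
  obtain ⟨L, hL⟩ := hLDL.choice
  obtain ⟨d, hd⟩ := hL.choice
  set M : κ → Matrix (Fin m) (Fin m) ℝ :=
    fun k => L k * Matrix.diagonal fun i => Real.sqrt (d k i) with hMdef
  have hentry : ∀ i j, ∃ a, Tendsto (fun k => M k i j) U (𝓝 a) := by
    intro i j
    refine exists_tendsto_of_eventually_norm_le U _ (C := Real.sqrt (S' i i + 1)) ?_
    have hSi : Tendsto (fun k => S k i i) U (𝓝 (S' i i)) :=
      ((continuous_id.matrix_elem i i).tendsto S').comp hS
    filter_upwards [hd, hSi.eventually (gt_mem_nhds (lt_add_one _))] with k hk1 hk2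
    rw [Real.norm_eq_abs]
    exact Real.abs_le_sqrt ((hk1.1.sq_le i j).trans hk2.le)
  obtain ⟨M', hM'⟩ : ∃ M' : Matrix (Fin m) (Fin m) ℝ, ∀ i j,
      Tendsto (fun k => M k i j) U (𝓝 (M' i j)) := by
    choose M' hM' using hentry
    exact ⟨Matrix.of M', hM'⟩
  have hMlim : Tendsto M U (𝓝 M') :=
    tendsto_pi_nhds.2 fun i => tendsto_pi_nhds.2 fun j => hM' i j
  have hprod : S' = M' * M'ᵀ := by
    have hc : Continuous fun N : Matrix (Fin m) (Fin m) ℝ => N * Nᵀ := by fun_prop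
    refine tendsto_nhds_unique (hS.congr' ?_) ((hc.tendsto _).comp hMlim)
    filter_upwards [hd] with k hk using hk.1.eq_mul_transpose
  have hdiag : ∀ᶠ k in (U : Filter κ), ∀ i, M k i i = Real.sqrt (d k i) := by
    filter_upwards [hd] with k hk i
    simp only [hMdef]
    rw [Matrix.mul_diagonal, hk.1.unit_diag, one_mul]
  -- The set of nonzero pivots takes finitely many values, so it is constant along `U`. On it the
  -- limit factor has diagonal at least `√σ`.
  obtain ⟨J, hJ⟩ := exists_eventually_eq_of_finite U
    fun k => Finset.univ.filter fun i => d k i ≠ 0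
  have hcard : J.card ≤ M'.rank := by
    refine card_le_rank_of_lower (fun i j hij => ?_) (fun i => ?_) J fun i hi => ?_
    · refine tendsto_nhds_unique (hM' i j) (tendsto_const_nhds.congr' ?_)
      filter_upwards [hd] with k hk
      simp only [hMdef]
      rw [Matrix.mul_diagonal, hk.1.lower i j hij, zero_mul]
    · refine ge_of_tendsto (hM' i i) ?_
      filter_upwards [hdiag] with k hk
      rw [hk]
      exact Real.sqrt_nonneg _
    · refine lt_of_lt_of_le (Real.sqrt_pos.2 hσ) (ge_of_tendsto (hM' i i) ?_)
      filter_upwards [hdiag, hd, hJ] with k hk1 hk2 hk3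
      rw [hk1]
      rw [← hk3] at hi
      exact Real.sqrt_le_sqrt (hk2.2 i (Finset.mem_filter.1 hi).2)
  rw [hprod, Matrix.rank_self_mul_transpose]
  filter_upwards [hd, hJ] with k hk1 hk2
  refine le_trans ?_ hcard
  rw [hk1.1.eq]
  refine (Matrix.rank_mul_le_left _ _).trans ((Matrix.rank_mul_le_right _ _).trans ?_)
  rw [Matrix.rank_diagonal, Fintype.card_subtype, ← hk2]

/-! Strata -/

theorem SameRep.rangeADiag_eq {A : Matrix (Fin m) (Fin n) ℝ} {y z : E n} (h : SameRep A y z) :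
    rangeADiag A y = rangeADiag A z := by
  obtain ⟨r, s, M, N, hy, hz⟩ := h
  rw [← hy.span_M, hz.span_M]

theorem exists_isRegularRep (A : Matrix (Fin m) (Fin n) ℝ) (y : E n) :
    ∃ (r s : ℕ) (M : Matrix (Fin r) (Fin m) ℝ) (N : Matrix (Fin s) (Fin m) ℝ),
      IsRegularRep A y M N := by
  have hbasis : ∀ V : Submodule ℝ (Fin m → ℝ), ∃ (r : ℕ) (M : Matrix (Fin r) (Fin m) ℝ),
      LinearIndependent ℝ (fun i => M i) ∧ Submodule.span ℝ (Set.range fun i => M i) = V := by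
    intro V
    let B := Module.finBasis ℝ V
    refine ⟨_, fun i => (B i : Fin m → ℝ), ?_, ?_⟩
    · exact B.linearIndependent.map' V.subtype V.ker_subtype
    · have h1 : (Set.range fun i => (B i : Fin m → ℝ)) = V.subtype '' Set.range B := by
        rw [← Set.range_comp]; rfl
      rw [h1, Submodule.span_image, B.span_eq, Submodule.map_top, Submodule.range_subtype]
  let W : Submodule ℝ (Fin m → ℝ) :=
    { carrier := {v | ∀ u ∈ rangeADiag A y, u ⬝ᵥ v = 0}
      zero_mem' := fun u _ => dotProduct_zero u
      add_mem' := fun {v w} hv hw u hu => by rw [dotProduct_add, hv u hu, hw u hu, add_zero]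
      smul_mem' := fun c v hv u hu => by rw [dotProduct_smul, hv u hu, smul_zero] }
  obtain ⟨r, M, hM, hM'⟩ := hbasis (rangeADiag A y)
  obtain ⟨s, N, hN, hN'⟩ := hbasis W
  refine ⟨r, s, M, N, hM, hM', hN, ?_⟩
  rw [hN']
  rfl

/-- Both row spaces of a representation are determined by the range, so a stratum is a level set of
`rangeADiag`. -/
theorem sameRep_iff {A : Matrix (Fin m) (Fin n) ℝ} {y z : E n} :
    SameRep A y z ↔ rangeADiag A y = rangeADiag A z := by
  refine ⟨SameRep.rangeADiag_eq, fun h => ?_⟩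
  obtain ⟨r, s, M, N, hy⟩ := exists_isRegularRep A y
  refine ⟨r, s, M, N, hy, hy.linInd_M, ?_, hy.linInd_N, ?_⟩
  · rw [← h, hy.span_M]
  · rw [← h, hy.span_N]

theorem maxSupport_congr {A : Matrix (Fin m) (Fin n) ℝ} {b : Fin m → ℝ} {y z : E n}
    (h : rangeADiag A y = rangeADiag A z) : maxSupport A b y = maxSupport A b z := by
  simp only [maxSupport, stratum, sameRep_iff, h]

/-- Limits of `σ`-regular points stay in the stratum. -/
theorem eventually_rangeADiag_eq {κ : Type*} (U : Ultrafilter κ) (A : Matrix (Fin m) (Fin n) ℝ)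
    {σ : ℝ} (hσ : 0 < σ) {y : κ → E n} {a : E n} (hy : Tendsto y U (𝓝 a))
    (hreg : ∀ᶠ k in (U : Filter κ), SigmaRegular A σ (y k)) :
    ∀ᶠ k in (U : Filter κ), rangeADiag A (y k) = rangeADiag A a := by
  have hc : Continuous fun z : E n => A * Matrix.diagonal (had z z).ofLp * Aᵀ := by
    have h1 : Continuous fun z : E n => Matrix.diagonal (had z z).ofLp :=
      ((PiLp.continuous_ofLp 2 _).comp continuous_had).matrix_diagonal
    exact (continuous_const.matrix_mul h1).matrix_mul continuous_const
  have hrank := eventually_rank_le_of_tendsto U hσ ((hc.tendsto a).comp hy) hreg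
  have hsupp : ∀ᶠ k in (U : Filter κ), ∀ i, a i ≠ 0 → y k i ≠ 0 := by
    rw [eventually_all]
    intro i
    by_cases hi : a i = 0
    · exact Eventually.of_forall fun k h => absurd hi h
    · have h1 : Tendsto (fun k => y k i) U (𝓝 (a i)) :=
        ((by fun_prop : Continuous fun z : E n => z i).tendsto a).comp hy
      filter_upwards [h1.eventually_ne hi] with k hk _ using hk
  filter_upwards [hrank, hsupp] with k hk1 hk2
  -- Supports can only shrink in the limit, which gives one inclusion of ranges; the rank bound
  -- makes it an equality.
  refine (Submodule.eq_of_le_of_finrank_le (rangeADiag_mono A hk2) ?_).symm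
  rw [finrank_rangeADiag, finrank_rangeADiag]
  exact hk1

/-! ### First-order expansions and the Riemannian step. -/

open Asymptotics

/-- First-order expansion, uniform in the base point, of a map that is continuously differentiable
on a set containing the fibres under consideration. -/
theorem isLittleO_of_contDiffWithinAt {κ X : Type*} [NormedAddCommGroup X] [NormedSpace ℝ X]
    {l : Filter κ} {F : X × X → X} {T : Set (X × X)} {a γ : X}
    (hF : ContDiffWithinAt ℝ 1 F T (a, 0)) (hline : ∀ τ : ℝ, (a, τ • γ) ∈ T)
    (hderiv : HasDerivAt (fun τ : ℝ => F (a, τ • γ)) γ 0)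
    {y g : κ → X} {s : κ → ℝ} (hy : Tendsto y l (𝓝 a)) (hg : Tendsto g l (𝓝 γ))
    (hs : ∀ k, 0 < s k) (hs0 : Tendsto s l (𝓝 0))
    (hT : ∀ᶠ k in l, ∀ τ : ℝ, (y k, τ • g k) ∈ T) (hF0 : ∀ᶠ k in l, F (y k, 0) = y k) :
    (fun k => F (y k, s k • g k) - y k - s k • γ) =o[l] s := by
  have haT : (a, (0 : X)) ∈ T := by simpa using hline 0
  rw [show (1 : ℕ∞ω) = 0 + 1 from (zero_add 1).symm] at hF
  obtain ⟨u, hu, -, -, F', hF', hF'c⟩ :=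
    (contDiffWithinAt_succ_iff_hasFDerivWithinAt' (by simp)).1 hF
  rw [Set.insert_eq_of_mem haT] at hu
  have hcurve : ∀ (z h : X) (τ : ℝ), HasDerivAt (fun τ : ℝ => (z, τ • h)) ((0 : X), h) τ := by
    intro z h τ
    refine (hasDerivAt_const τ z).prodMk ?_
    simpa using (hasDerivAt_id τ).smul_const h
  have hcomp : ∀ (z h : X) (τ : ℝ), (∀ τ : ℝ, (z, τ • h) ∈ T) → (z, τ • h) ∈ u →
      HasDerivAt (fun τ : ℝ => F (z, τ • h)) (F' (z, τ • h) (0, h)) τ := by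
    intro z h τ hzT hzu
    rw [← hasDerivWithinAt_univ]
    exact (hF' _ hzu).comp_hasDerivWithinAt τ (hcurve z h τ).hasDerivWithinAt fun τ _ => hzT τ
  -- `T` need not determine derivatives uniquely, so `F'` is pinned down only along the line in `T`,
  -- by uniqueness of the one-variable derivative.
  have hbase : F' (a, 0) (0, γ) = γ := by
    have := hcomp a γ 0 hline (by rw [zero_smul]; exact mem_of_mem_nhdsWithin haT hu)
    rw [zero_smul] at this
    exact this.unique hderiv
  rw [isLittleO_iff]
  intro η hη
  have hlim : Tendsto (fun p : (X × X) × X => F' p.1 (0, p.2)) (𝓝[T] (a, 0) ×ˢ 𝓝 γ) (𝓝 γ) := by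
    have h1 : Tendsto (fun p : (X × X) × X => F' p.1) (𝓝[T] (a, 0) ×ˢ 𝓝 γ) (𝓝 (F' (a, 0))) :=
      hF'c.continuousWithinAt.tendsto.comp tendsto_fst
    have h2 : Tendsto (fun p : (X × X) × X => ((0 : X), p.2)) (𝓝[T] (a, 0) ×ˢ 𝓝 γ)
        (𝓝 ((0 : X), γ)) := tendsto_const_nhds.prodMk_nhds tendsto_snd
    have h3 := ((isBoundedBilinearMap_apply (𝕜 := ℝ) (E := X × X) (F := X)).continuous.tendsto
      (F' (a, 0), ((0 : X), γ))).comp (h1.prodMk_nhds h2)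
    simp only [hbase] at h3
    exact h3
  obtain ⟨P, hP, Q, hQ, hPQ⟩ := eventually_prod_iff.1 (Metric.tendsto_nhds.1 hlim η hη)
  obtain ⟨r, hr, hball⟩ := Metric.mem_nhdsWithin_iff.1 (inter_mem hP hu)
  have hsg : Tendsto (fun k => s k * ‖g k‖) l (𝓝 0) := by simpa using hs0.mul hg.norm
  filter_upwards [hT, hF0, hg.eventually hQ, hsg.eventually (gt_mem_nhds hr),
    Metric.tendsto_nhds.1 hy r hr] with k hk1 hk2 hk3 hk4 hk5
  have hin : ∀ τ ∈ Set.Icc 0 (s k), (y k, τ • g k) ∈ {p | P p} ∩ u := by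
    intro τ hτ
    refine hball ⟨?_, hk1 τ⟩
    rw [Metric.mem_ball, Prod.dist_eq, max_lt_iff]
    refine ⟨hk5, ?_⟩
    rw [dist_zero_right, norm_smul, Real.norm_of_nonneg hτ.1]
    exact lt_of_le_of_lt (mul_le_mul_of_nonneg_right hτ.2 (norm_nonneg _)) hk4
  -- Mean value inequality along the fibre segment, on which the derivative stays within `η` of `γ`.
  have hmvt := norm_image_sub_le_of_norm_deriv_le_segment'
    (f := fun τ : ℝ => F (y k, τ • g k) - τ • γ)
    (f' := fun τ => F' (y k, τ • g k) (0, g k) - γ) (a := 0) (b := s k) (C := η)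
    (fun τ hτ => by
      refine ((hcomp (y k) (g k) τ hk1 (hin τ hτ).2).sub ?_).hasDerivWithinAt
      simpa using (hasDerivAt_id τ).smul_const γ)
    (fun τ hτ => by
      rw [← dist_eq_norm]
      exact (hPQ (hin τ ⟨hτ.1, hτ.2.le⟩).1 hk3).le)
    (s k) (Set.right_mem_Icc.2 (hs k).le)
  simp only [zero_smul, sub_zero, hk2] at hmvt
  rw [Real.norm_of_nonneg (hs k).le]
  rwa [sub_right_comm]

theorem hasStrictFDerivAt_had_self (a : E n) : ∃ D : E n →L[ℝ] E n,
    HasStrictFDerivAt (fun y : E n => had y y) D a ∧ ∀ h, D h = (2 : ℝ) • had a h := by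
  let D : E n →ₗ[ℝ] E n :=
    { toFun := fun h => (2 : ℝ) • had a h
      map_add' := fun g h => by ext i; simp [had]; ring
      map_smul' := fun c h => by ext i; simp [had]; ring }
  refine ⟨LinearMap.toContinuousLinearMap D, ?_, fun h => rfl⟩
  rw [hasStrictFDerivAt_euclidean]
  intro i
  have h1 := (PiLp.proj (𝕜 := ℝ) 2 (fun _ : Fin n => ℝ) i).hasStrictFDerivAt (x := a)
  refine (h1.mul h1).congr_fderiv ?_
  ext h
  simp [D, had]
  ring

/-- The Euclidean gradient of `f(y) = φ(y ∘ y)`. -/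
theorem hasStrictFDerivAt_comp_had {φ : E n → ℝ} (hφ : ContDiff ℝ 1 φ) (a : E n) :
    HasStrictFDerivAt (fun y : E n => φ (had y y))
      (innerSL ℝ ((2 : ℝ) • had (gradient φ (had a a)) a)) a := by
  obtain ⟨D, hD, hD'⟩ := hasStrictFDerivAt_had_self a
  have h1 := (hφ.contDiffAt (x := had a a)).hasStrictFDerivAt one_ne_zero
  refine (HasStrictFDerivAt.comp (f := fun y : E n => had y y) a h1 hD).congr_fderiv ?_
  ext h
  simp only [ContinuousLinearMap.comp_apply, fderiv_eq_inner_gradient, hD', innerSL_apply_apply,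
    PiLp.inner_apply, had, RCLike.inner_apply, conj_trivial, PiLp.smul_apply, smul_eq_mul]
  exact Finset.sum_congr rfl fun i _ => by ring

theorem continuous_euclideanGradient {φ : E n → ℝ} (hφ : ContDiff ℝ 1 φ) :
    Continuous fun y : E n => (2 : ℝ) • had (gradient φ (had y y)) y := by
  have h1 : Continuous fun y : E n => gradient φ (had y y) :=
    (continuous_gradient hφ).comp continuous_had
  have h2 : Continuous fun p : E n × E n => had p.1 p.2 := by unfold had; fun_prop
  exact (h2.comp (h1.prodMk continuous_id)).const_smul (2 : ℝ)

/-- Orthogonality of the projection error to the tangent space; this identity passes to limits. -/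
theorem norm_rgrad_sq (A : Matrix (Fin m) (Fin n) ℝ) (b : Fin m → ℝ) (φ : E n → ℝ) (y : E n) :
    ‖rgrad A b φ y‖ ^ 2 =
      inner ℝ ((2 : ℝ) • had (gradient φ (had y y)) y) (rgrad A b φ y) := by
  have := (tangentSpace A b y).starProjection_inner_eq_zero
    ((2 : ℝ) • had (gradient φ (had y y)) y) (rgrad A b φ y)
    (Submodule.starProjection_apply_mem _ _)
  change inner ℝ (_ - rgrad A b φ y) _ = (0 : ℝ) at this
  rw [inner_sub_left, real_inner_self_eq_norm_sq] at this
  linarith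

theorem norm_rgrad_le (A : Matrix (Fin m) (Fin n) ℝ) (b : Fin m → ℝ) (φ : E n → ℝ) (y : E n) :
    ‖rgrad A b φ y‖ ≤ ‖(2 : ℝ) • had (gradient φ (had y y)) y‖ :=
  (tangentSpace A b y).norm_starProjection_apply_le _

theorem rgrad_mem (A : Matrix (Fin m) (Fin n) ℝ) (b : Fin m → ℝ) (φ : E n → ℝ) (y : E n) :
    rgrad A b φ y ∈ tangentSpace A b y :=
  Submodule.starProjection_apply_mem _ _

/-- Near a point of a stratum, the Riemannian gradient step of small size gives sufficient decrease
as long as the Riemannian gradient is bounded away from zero. -/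
theorem not_tendsto_zero_of_not_RGDDecrease {κ : Type*} (U : Ultrafilter κ)
    {A : Matrix (Fin m) (Fin n) ℝ} {b : Fin m → ℝ} {φ : E n → ℝ} (hφ : ContDiff ℝ 1 φ)
    {R : E n → E n → E n} (hR : IsRetraction A b R) {δ ε : ℝ} (hδ : δ < 1)
    (hε : 0 < ε) {y : κ → E n} {a : E n} {s : κ → ℝ} (hymem : ∀ k, y k ∈ paramPolyhedron A b)
    (hy : Tendsto y U (𝓝 a))
    (hrange : ∀ᶠ k in (U : Filter κ), rangeADiag A (y k) = rangeADiag A a)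
    (hgrad : ∀ᶠ k in (U : Filter κ), ε < ‖rgrad A b φ (y k)‖) (hs : ∀ k, 0 < s k)
    (hfail : ∀ᶠ k in (U : Filter κ), ¬ RGDDecrease A b φ R δ (s k) (y k)) :
    ¬ Tendsto s U (𝓝 0) := by
  intro hs0
  have ha : a ∈ paramPolyhedron A b :=
    (isClosed_paramPolyhedron A b).mem_of_tendsto hy (Eventually.of_forall hymem)
  have hv : Tendsto (fun k => (2 : ℝ) • had (gradient φ (had (y k) (y k))) (y k)) U
      (𝓝 ((2 : ℝ) • had (gradient φ (had a a)) a)) :=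
    ((continuous_euclideanGradient hφ).tendsto a).comp hy
  -- Boundedness gives a limit along `U`, so continuity of the Riemannian gradient is not needed,
  -- nor is `γ` identified with `rgrad A b φ a`.
  obtain ⟨γ, hγ⟩ := exists_tendsto_of_eventually_norm_le U (fun k => rgrad A b φ (y k))
    (C := ‖(2 : ℝ) • had (gradient φ (had a a)) a‖ + 1) (by
      filter_upwards [hv.norm.eventually (gt_mem_nhds (lt_add_one _))] with k hk
      exact (norm_rgrad_le A b φ (y k)).trans hk.le)
  have hγT : γ ∈ tangentSpace A b a := by
    refine ⟨?_, fun i hi => ?_⟩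
    · have hc : Continuous fun p : E n × E n => A *ᵥ (had p.1 p.2).ofLp := by
        unfold had; fun_prop
      refine tendsto_nhds_unique ((hc.tendsto (a, γ)).comp (hy.prodMk_nhds hγ)) ?_
      refine tendsto_const_nhds.congr fun k => (rgrad_mem A b φ (y k)).1.symm
    · have h1 : Tendsto (fun k => rgrad A b φ (y k) i) U (𝓝 (γ i)) :=
        ((by fun_prop : Continuous fun z : E n => z i).tendsto γ).comp hγ
      obtain ⟨k, hk1, hk2⟩ := ((h1.eventually_ne hi).and hrange).exists
      rw [← maxSupport_congr hk2]
      exact (rgrad_mem A b φ (y k)).2 i hk1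
  have hγε : 0 < ‖γ‖ :=
    lt_of_lt_of_le hε (ge_of_tendsto hγ.norm (hgrad.mono fun k hk => hk.le))
  have hinner : inner ℝ ((2 : ℝ) • had (gradient φ (had a a)) a) γ = ‖γ‖ ^ 2 :=
    tendsto_nhds_unique (hv.inner hγ)
      ((hγ.norm.pow 2).congr fun k => norm_rgrad_sq A b φ (y k))
  have haS : a ∈ stratum A b a := ⟨ha, sameRep_iff.2 rfl⟩
  have hexp := isLittleO_of_contDiffWithinAt (F := fun p : E n × E n => R p.1 p.2)
    (T := tangentBundle A b a) (γ := -γ) (g := fun k => -rgrad A b φ (y k))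
    (((hR.smooth a ha) (a, 0) ⟨haS, Submodule.zero_mem _⟩).of_le (by exact_mod_cast le_top))
    (fun τ => ⟨haS, Submodule.smul_mem _ _ (Submodule.neg_mem _ hγT)⟩)
    (by
      have h1 : HasDerivAt (fun τ : ℝ => τ • (-γ)) (-γ) 0 := by
        simpa using (hasDerivAt_id (0 : ℝ)).smul_const (-γ)
      have h2 := hR.deriv_zero a ha
      rw [← zero_smul ℝ (-γ)] at h2
      rw [← hasDerivWithinAt_univ]
      exact h2.comp_hasDerivWithinAt 0 h1.hasDerivWithinAt
        fun τ _ => Submodule.smul_mem _ _ (Submodule.neg_mem _ hγT))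
    hy hγ.neg hs hs0
    (hrange.mono fun k hk τ => ⟨⟨hymem k, sameRep_iff.2 hk⟩,
      Submodule.smul_mem _ _ (Submodule.neg_mem _ (rgrad_mem A b φ (y k)))⟩)
    (Eventually.of_forall fun k => hR.map_zero _ (hymem k))
  simp only [smul_neg, sub_neg_eq_add] at hexp
  set z : κ → E n := fun k => R (y k) (-(s k • rgrad A b φ (y k)))
  have hdiffO : (fun k => z k - y k) =O[U] s := by
    have h1 : (fun k => s k • γ) =O[U] s :=
      IsBigO.of_bound ‖γ‖ (Eventually.of_forall fun k => by rw [norm_smul, mul_comm])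
    simpa using hexp.isBigO.sub h1
  have hz : Tendsto z U (𝓝 a) := by
    simpa using (hdiffO.trans_tendsto hs0).add hy
  have hf := (((hasStrictFDerivAt_comp_had hφ a).isLittleO.comp_tendsto
    (hz.prodMk_nhds hy)).trans_isBigO hdiffO)
  have hlin := ((innerSL ℝ ((2 : ℝ) • had (gradient φ (had a a)) a)).isBigO_comp _ _).trans_isLittleO
    hexp
  have htot := hf.add hlin
  -- The gap `(1 - δ) * ‖γ‖ ^ 2` is split evenly between the first-order remainder and the error in
  -- `δ * ‖rgrad A b φ (y k)‖ ^ 2`.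
  have hη : 0 < (1 - δ) * ‖γ‖ ^ 2 / 2 := by
    have := sub_pos.2 hδ
    positivity
  have hδg : Tendsto (fun k => δ * ‖rgrad A b φ (y k)‖ ^ 2) U (𝓝 (δ * ‖γ‖ ^ 2)) :=
    (hγ.norm.pow 2).const_mul δ
  obtain ⟨k, hk1, hk2, hk3⟩ := (hfail.and ((htot.bound hη).and
    (hδg.eventually (gt_mem_nhds (lt_add_of_pos_right _ hη))))).exists
  rw [RGDDecrease, not_le] at hk1
  change _ < φ (had (z k) (z k)) at hk1
  rw [Real.norm_of_nonneg (hs k).le, Real.norm_eq_abs] at hk2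
  have hk2' := le_of_abs_le hk2
  simp only [Function.comp_apply, innerSL_apply_apply, inner_add_right, inner_sub_right,
    inner_smul_right, hinner] at hk2'
  have hsk := mul_lt_mul_of_pos_left hk3 (hs k)
  nlinarith

/-! ### Feasibility and monotonicity of the iterates. -/

theorem IsAlgSequence.mem {A : Matrix (Fin m) (Fin n) ℝ} {b : Fin m → ℝ} {φ : E n → ℝ}
    {R : E n → E n → E n} (hR : IsRetraction A b R) {δ σ ε : ℝ} {y₀ : E n}
    (hy₀ : y₀ ∈ paramPolyhedron A b) {y : ℕ → E n} (hy : IsAlgSequence A b φ R δ σ ε y₀ y) :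
    ∀ k, y k ∈ paramPolyhedron A b := by
  intro k
  induction k with
  | zero => rwa [hy.start]
  | succ k ih =>
    rcases hy.step k with ⟨-, j, -, hj⟩ | ⟨-, j, -, hj⟩
    · rw [hj]
      exact (hR.maps (y k) ih (y k, _) ⟨⟨ih, sameRep_iff.2 rfl⟩,
        Submodule.neg_mem _ (Submodule.smul_mem _ _ (rgrad_mem A b φ (y k)))⟩).1
    · have h := pgPoint_mem (had_self_mem_polyhedron ih) φ ((1 / 2 : ℝ) ^ j)
      rw [hj, paramPolyhedron, Set.mem_ofPred_eq, had_sqrtVec h.2]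
      exact h.1

theorem RGDStep.decrease {A : Matrix (Fin m) (Fin n) ℝ} {b : Fin m → ℝ} {φ : E n → ℝ}
    {R : E n → E n → E n} {δ : ℝ} {y y' : E n} {j : ℕ}
    (hj : IsLeast {k : ℕ | RGDDecrease A b φ R δ ((1 / 2 : ℝ) ^ k) y} j)
    (hy' : y' = R y (-(((1 / 2 : ℝ) ^ j) • rgrad A b φ y))) :
    φ (had y' y') ≤ φ (had y y) - (1 / 2 : ℝ) ^ j * δ * ‖rgrad A b φ y‖ ^ 2 := by
  rw [hy']
  exact hj.1

theorem PGDStep.decrease {A : Matrix (Fin m) (Fin n) ℝ} {b : Fin m → ℝ} {φ : E n → ℝ}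
    {δ : ℝ} {y y' : E n} {j : ℕ} (hy : y ∈ paramPolyhedron A b)
    (hj : IsLeast {k : ℕ | 1 ≤ k ∧ PGDDecrease A b φ δ ((1 / 2 : ℝ) ^ k) (had y y)} j)
    (hy' : y' = sqrtVec (pgPoint A b φ ((1 / 2 : ℝ) ^ j) (had y y))) :
    φ (had y' y') ≤
      φ (had y y) - (1 / 2 : ℝ) ^ j * δ * pgResidual A b φ ((1 / 2 : ℝ) ^ j) (had y y) ^ 2 := by
  rw [hy', had_sqrtVec (pgPoint_mem (had_self_mem_polyhedron hy) φ _).2]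
  exact hj.1.2

theorem AlgStep.decrease {A : Matrix (Fin m) (Fin n) ℝ} {b : Fin m → ℝ} {φ : E n → ℝ}
    {R : E n → E n → E n} {δ σ ε : ℝ} (hδ : 0 ≤ δ) {y y' : E n} (hy : y ∈ paramPolyhedron A b)
    (h : AlgStep A b φ R δ σ ε y y') : φ (had y' y') ≤ φ (had y y) := by
  rcases h with ⟨-, j, hj, hy'⟩ | ⟨-, j, hj, hy'⟩
  · refine (RGDStep.decrease hj hy').trans (sub_le_self _ ?_)
    positivity
  · refine (PGDStep.decrease hy hj hy').trans (sub_le_self _ ?_)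
    positivity

/-- Along an ultrafilter witnessing an accumulation point, the successive decreases of a monotone
continuous quantity tend to zero. -/
theorem tendsto_decrease_zero {U : Ultrafilter ℕ} (hU : (U : Filter ℕ) ≤ atTop) {f : ℕ → ℝ} {c : ℝ}
    (hf : Antitone f) (hc : Tendsto f U (𝓝 c)) : Tendsto (fun k => f k - f (k + 1)) U (𝓝 0) := by
  -- `U` is not shift invariant, so convergence of `f (k + 1)` is not immediate. Monotonicity makes
  -- `c` a global lower bound, which suffices.
  have hlb : ∀ k, c ≤ f k := fun k =>
    le_of_tendsto hc (hU ((eventually_ge_atTop k).mono fun j hj => hf hj))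
  refine squeeze_zero (g := fun k => f k - c) (fun k => sub_nonneg.2 (hf k.le_succ))
    (fun k => sub_le_sub_left (hlb _) _) ?_
  simpa using hc.sub_const c

/-- Doubling the accepted step recovers the preceding trial step. -/
theorem two_mul_half_pow {j : ℕ} (hj : 1 ≤ j) : 2 * (1 / 2 : ℝ) ^ j = (1 / 2 : ℝ) ^ (j - 1) := by
  obtain ⟨i, rfl⟩ := Nat.exists_eq_add_of_le hj
  rw [Nat.add_sub_cancel_left, pow_add]
  ring

end HadamardLCP

/-! ### Convergence of the hybrid algorithm. -/

open HadamardLCP Filter Topology in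
theorem theorem1 {m n : ℕ} (A : Matrix (Fin m) (Fin n) ℝ) (b : Fin m → ℝ)
    (φ : EuclideanSpace ℝ (Fin n) → ℝ)
    (hφ : ContDiff ℝ 1 φ)
    (hA : LinearIndependent ℝ (fun i => A i))
    (R : EuclideanSpace ℝ (Fin n) → EuclideanSpace ℝ (Fin n) → EuclideanSpace ℝ (Fin n))
    (hR : HadamardLCP.IsRetraction A b R)
    (δ σ ε : ℝ) (hδ : δ ∈ Set.Ioo (0 : ℝ) 1) (hσ : σ ∈ Set.Ioo (0 : ℝ) 1)
    (hε : ε ∈ Set.Ioo (0 : ℝ) 1)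
    (y₀ : EuclideanSpace ℝ (Fin n)) (hy₀ : y₀ ∈ HadamardLCP.paramPolyhedron A b)
    (y : ℕ → EuclideanSpace ℝ (Fin n))
    (hy : HadamardLCP.IsAlgSequence A b φ R δ σ ε y₀ y)
    (ystar : EuclideanSpace ℝ (Fin n)) (hstar : MapClusterPt ystar Filter.atTop y) :
    HadamardLCP.IsKKTPoint A b φ (HadamardLCP.had ystar ystar) := by
  obtain ⟨hδ0, hδ1⟩ := hδ
  obtain ⟨U, hU, hlim⟩ := mapClusterPt_iff_ultrafilter.1 hstar
  have hmem := hy.mem hR hy₀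
  have hx : ∀ k, had (y k) (y k) ∈ polyhedron A b := fun k => had_self_mem_polyhedron (hmem k)
  have hxlim : Tendsto (fun k => had (y k) (y k)) U (𝓝 (had ystar ystar)) :=
    (continuous_had.tendsto ystar).comp hlim
  have hdec : Tendsto (fun k => φ (had (y k) (y k)) - φ (had (y (k + 1)) (y (k + 1)))) U (𝓝 0) :=
    tendsto_decrease_zero hU (f := fun k => φ (had (y k) (y k)))
      (antitone_nat_of_succ_le fun k => (hy.step k).decrease hδ0.le (hmem k))
      ((hφ.continuous.tendsto _).comp hxlim)
  have hxstar : had ystar ystar ∈ polyhedron A b :=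
    (isClosed_polyhedron A b).mem_of_tendsto hxlim (Eventually.of_forall hx)
  have hpow : ∀ j : ℕ, (0 : ℝ) < (1 / 2) ^ j := fun j => by positivity
  rcases Ultrafilter.eventually_or.1 (Eventually.of_forall (f := (U : Filter ℕ)) hy.step) with
    hstep | hstep
  · exfalso
    obtain ⟨j, hj⟩ := (hstep.mono fun k hk => hk.2).choice
    have ht : Tendsto (fun k => (1 / 2 : ℝ) ^ j k) U (𝓝 0) := by
      have hC : 0 < δ * ε ^ 2 := mul_pos hδ0 (pow_pos hε.1 2)
      refine squeeze_zero' (Eventually.of_forall fun k => (hpow _).le) ?_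
        (by simpa using hdec.div_const (δ * ε ^ 2))
      filter_upwards [hstep, hj] with k hk1 hk2
      rw [le_div_iff₀ hC]
      have h1 := RGDStep.decrease hk2.1 hk2.2
      have h2 : (1 / 2 : ℝ) ^ j k * (δ * ε ^ 2) ≤ (1 / 2 : ℝ) ^ j k * (δ * ‖rgrad A b φ (y k)‖ ^ 2) :=
        mul_le_mul_of_nonneg_left (mul_le_mul_of_nonneg_left
          (pow_le_pow_left₀ hε.1.le hk1.1.2.le 2) hδ0.le) (hpow _).le
      linarith
    refine not_tendsto_zero_of_not_RGDDecrease U hφ hR hδ1 hε.1 (s := fun k => 2 * (1 / 2) ^ j k)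
      hmem hlim (eventually_rangeADiag_eq U A hσ.1 hlim (hstep.mono fun k hk => hk.1.1))
      (hstep.mono fun k hk => hk.1.2) (fun k => mul_pos two_pos (hpow _)) ?_
      (by simpa using ht.const_mul 2)
    -- Steps below 1 have positive exponent, so a preceding trial exists, and minimality says it
    -- failed.
    filter_upwards [hj, ht.eventually (gt_mem_nhds one_pos)] with k hk1 hk2 hcon
    have hj1 : 1 ≤ j k := by
      by_contra h0
      rw [not_le, Nat.lt_one_iff] at h0
      simp [h0] at hk2
    rw [two_mul_half_pow hj1] at hcon
    have := hk1.1.2 hcon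
    omega
  · refine isKKTPoint_of_variational hxstar ?_
    obtain ⟨j, hj⟩ := (hstep.mono fun k hk => hk.2).choice
    obtain ⟨τ, hτ⟩ := exists_tendsto_of_eventually_norm_le U (fun k => (1 / 2 : ℝ) ^ j k) (C := 1)
      (Eventually.of_forall fun k => by
        rw [Real.norm_of_nonneg (hpow _).le]
        exact pow_le_one₀ (by norm_num) (by norm_num))
    by_cases hτ0 : τ = 0
    · rw [hτ0] at hτ
      have hs0 : Tendsto (fun k => 2 * (1 / 2 : ℝ) ^ j k) U (𝓝 0) := by
        simpa using hτ.const_mul 2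
      have hs : ∀ k, 0 < 2 * (1 / 2 : ℝ) ^ j k := fun k => mul_pos two_pos (hpow _)
      refine variational_of_tendsto_pgResidual hφ hx hxlim hs
        ((hs0.eventually (gt_mem_nhds one_pos)).mono fun k hk => hk.le)
        (tendsto_pgResidual_of_not_decrease hφ hδ1 hx hxlim hs hs0 ?_)
      filter_upwards [hj, hs0.eventually (gt_mem_nhds one_pos)] with k hk1 hk2 hcon
      have hj1 : 1 ≤ j k := hk1.1.1.1
      -- Projected trials start at exponent 1, so the preceding exponent is admissible only when `j
      -- k ≥ 2`; a doubled step below 1 ensures this.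
      have hj2 : j k ≠ 1 := fun h => by norm_num [h] at hk2
      rw [two_mul_half_pow hj1] at hcon
      have := hk1.1.2 ⟨by omega, hcon⟩
      omega
    · refine variational_of_tendsto_pgResidual hφ hx hxlim (s := fun k => (1 / 2) ^ j k)
        (fun k => hpow _)
        (Eventually.of_forall fun k => pow_le_one₀ (by norm_num) (by norm_num)) ?_
      have hsq : Tendsto (fun k => pgResidual A b φ ((1 / 2) ^ j k) (had (y k) (y k)) ^ 2) U
          (𝓝 0) := by
        have h0 := hdec.div (hτ.mul_const δ) (mul_ne_zero hτ0 hδ0.ne')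
        rw [zero_div] at h0
        refine squeeze_zero' (Eventually.of_forall fun k => sq_nonneg _) ?_ h0
        filter_upwards [hj] with k hk
        have h1 := PGDStep.decrease (hmem k) hk.1 hk.2
        rw [Pi.div_apply, le_div_iff₀ (mul_pos (hpow _) hδ0)]
        linarith
      have := hsq.sqrt
      simpa only [Real.sqrt_sq (pgResidual_nonneg (hpow _) _), Real.sqrt_zero] using this
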